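/- Let $\Bbbk$ be a commutative unital ring, $A$ a unital associative $\Bbbk$-algebra, $\Omega_d^\bullet$ an exterior algebra over $A$ (a differential graded $\Bbbk$-algebra with $\Omega_d^0=A$, generated by $A$ and $dA$), and $E$ a left $A$-module. Let $J_d^nE$ be the holonomic $n$-jet module of $E$ with prolongation $j_d^n\colon E\to J_d^nE$: $J_d^0E=E$, $J_d^1E=J_d^1A\otimes_AE$ with $J_d^1A=(A\otimes A)/\{\sum_i a_i\otimes b_i:\sum_i a_ib_i=0,\ \sum_i a_i\,db_i=0\}$, and, for $n\ge 2$, $J_d^nE$ is the kernel of the composite $J_d^1J_d^{n-1}E\to J_d^1J_d^1J_d^{n-2}E\to(\Omega_d^1\ltimes\Omega_d^2)\otimes_A J_d^{n-2}E$, where the first map is $J_d^1$ of the canonical map $J_d^{n-1}E\to J_d^1J_d^{n-2}E$ and the second is $[a\otimes b]\otimes[c\otimes e]\mapsto(a\,d(bc)+da\wedge d(bc))\otimes e$; here $\Omega_d^1\ltimes\Omega_d^2$ has left action $f(\alpha+\beta)=f\alpha+df\wedge\alpha+f\beta$ and componentwise right action. Let $\mathrm{Diff}^n=\mathrm{Diff}^n_d(E,E)$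 be the $\Bbbk$-linear maps $E\to E$ of the form $\widetilde\Delta\circ j_d^n$ with $\widetilde\Delta\colon J_d^nE\to E$ $A$-linear, let $\mathrm{Symb}^n=\mathrm{Diff}^n/\mathrm{Diff}^{n-1}$ (with $\mathrm{Diff}^{-1}=0$), $\varsigma^n\colon\mathrm{Diff}^n\to\mathrm{Symb}^n$ the projection, $\mathrm{Symb}^\bullet=\bigoplus_n\mathrm{Symb}^n$, and let $\varsigma^n(\Delta)\cdot\varsigma^m(\Delta')=\varsigma^{n+m}(\Delta\circ\Delta')$ be the symbol product. Let $q$ be a full quantization for $(E,E)$: a family of left ${}_A\mathrm{Hom}(E,E)$-linear maps $q^n\colon\mathrm{Symb}^n\to\mathrm{Diff}^n$ with $\varsigma^n\circ q^n=\mathrm{id}$ for all $n\ge 0$. For $\Delta\in\mathrm{Diff}^N$ put $\Delta_j=\Delta$ for $j\ge N$ and, recursively, $\Delta_j=\Delta_{j+1}-q^{j+1}(\varsigma^{j+1}(\Delta_{j+1}))\in\mathrm{Diff}^j$ for $0\le j<N$; set $[\Delta]^j=\varsigma^j(\Delta_j)$. For $a\in\mathrm{Symb}^n$, $b\in\mathrm{Symb}^m$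 let $$a\mathbin{\hat\star}b=\sum_{i=0}^{n+m}h^i\,[q^n(a)\circ q^m(b)]^{\,n+m-i}\in\mathrm{Symb}^\bullet[h]=\mathrm{Symb}^\bullet\otimes\Bbbk[h],$$ extended $\Bbbk[h]$-bilinearly to $\mathrm{Symb}^\bullet[h]$; for $\hbar\in\Bbbk$ let $\star_\hbar$ be the $\Bbbk$-bilinear product $a\star_\hbar b=\mathrm{ev}_\hbar(a\mathbin{\hat\star}b)$ on $\mathrm{Symb}^\bullet$, where $\mathrm{ev}_\hbar$ substitutes $h=\hbar$. Then: 1. $(\mathrm{Symb}^\bullet[h],\hat\star)$ is a unital associative $\Bbbk[h]$-algebra with unit $\mathrm{id}_E\in\mathrm{Symb}^0$, filtered by the submodules $\bigoplus_{k=0}^n\mathrm{Symb}^k[h]$, $n\ge 0$. For all $a\in\mathrm{Symb}^n$, $b\in\mathrm{Symb}^m$, $$a\mathbin{\hat\star}b-a\cdot b\in h\bigoplus_{k=0}^{n+m-1}\mathrm{Symb}^k[h].$$ 2. For every $\hbar\in\Bbbk$, $(\mathrm{Symb}^\bullet,\star_\hbar)$ is a unital associative $\Bbbk$-algebra with unit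 $\mathrm{id}_E$, filtered by the submodules $\bigoplus_{k=0}^n\mathrm{Symb}^k$, which are the images under $\mathrm{ev}_\hbar$ of the submodules $\bigoplus_{k=0}^n\mathrm{Symb}^k[h]$. The map $\mathrm{ev}_\hbar$ induces an isomorphism of unital $\Bbbk$-algebras from the quotient of $(\mathrm{Symb}^\bullet[h],\hat\star)$ by the two-sided ideal generated by $h-\hbar$ onto $(\mathrm{Symb}^\bullet,\star_\hbar)$. For all $a\in\mathrm{Symb}^n$, $b\in\mathrm{Symb}^m$, $$a\star_\hbar b-a\cdot b\in\hbar\bigoplus_{k=0}^{n+m-1}\mathrm{Symb}^k.$$ (An empty direct sum is $0$.) -/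

import Mathlib

open scoped TensorProduct DirectSum Polynomial

universe u v w

noncomputable section

namespace NCJet

/-- An exterior algebra over the associative unital `k`-algebra `A`: a differential graded
`k`-algebra `Ω = ⨁ Ω^n` whose degree zero part is (a copy of) `A`, and which is generated as an
algebra by `A` and `dA`. -/
structure ExteriorCalculus (k : Type v) (A : Type u) (Ω : Type w) [CommRing k] [Ring A]
    [Algebra k A] [Ring Ω] [Algebra k Ω] where
  /-- the homogeneous components `Ω^n` -/
  grade : ℕ → Submodule k Ω
  isInternal : DirectSum.IsInternal grade
  mul_mem : ∀ {m n : ℕ} {α β : Ω}, α ∈ grade m → β ∈ grade n → α * β ∈ grade (m + n)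
  /-- the identification of `A` with `Ω^0` -/
  incl : A →ₐ[k] Ω
  incl_injective : Function.Injective incl
  range_incl : Subalgebra.toSubmodule incl.range = grade 0
  /-- the exterior derivative -/
  d : Ω →ₗ[k] Ω
  d_mem : ∀ {n : ℕ} {α : Ω}, α ∈ grade n → d α ∈ grade (n + 1)
  d_d : ∀ α : Ω, d (d α) = 0
  leibniz : ∀ {n : ℕ} {α : Ω}, α ∈ grade n →
    ∀ β : Ω, d (α * β) = d α * β + (-1) ^ n * (α * d β)
  generated : Algebra.adjoin k (Set.range incl ∪ Set.range fun a : A => d (incl a)) = ⊤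

section Calculus

variable {k : Type v} {A : Type u} {Ω : Type w} [CommRing k] [Ring A] [Algebra k A]
  [Ring Ω] [Algebra k Ω]

/-- A left `A`-module, together with its underlying `k`-module structure. -/
structure LMod (k : Type v) (A : Type u) [CommRing k] [Ring A] [Algebra k A] where
  carrier : Type u
  [grp : AddCommGroup carrier]
  [kmod : Module k carrier]
  [amod : Module A carrier]
  [tower : IsScalarTower k A carrier]

attribute [instance] LMod.grp LMod.kmod LMod.amod LMod.tower

/-- The `A`-linear map `A ⊗ E → P`, `a ⊗ x ↦ a • g x`, induced by a `k`-linear map `g : E → P`. -/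
def extend {E P : Type*} [AddCommGroup E] [Module k E] [AddCommGroup P] [Module k P] [Module A P]
    [IsScalarTower k A P] (g : E →ₗ[k] P) : A ⊗[k] E →ₗ[A] P :=
  TensorProduct.AlgebraTensorModule.lift (LinearMap.toSpanSingleton A (E →ₗ[k] P) g)

@[simp] theorem extend_tmul {E P : Type*} [AddCommGroup E] [Module k E] [AddCommGroup P]
    [Module k P] [Module A P] [IsScalarTower k A P] (g : E →ₗ[k] P) (a : A) (x : E) :
    extend g (a ⊗ₜ[k] x) = a • g x := rfl

/-- The map `A ⊗ A → A ⊗ E`, `a ⊗ b ↦ a ⊗ b x`. -/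
def rightAct {E : Type*} [AddCommGroup E] [Module k E] [Module A E] [IsScalarTower k A E]
    (x : E) : A ⊗[k] A →ₗ[A] A ⊗[k] E :=
  TensorProduct.AlgebraTensorModule.lTensor A A
    ((LinearMap.toSpanSingleton A E x).restrictScalars k)

@[simp] theorem rightAct_tmul {E : Type*} [AddCommGroup E] [Module k E] [Module A E]
    [IsScalarTower k A E] (x : E) (a b : A) :
    rightAct x (a ⊗ₜ[k] b) = a ⊗ₜ[k] (b • x) := rfl

namespace ExteriorCalculus

variable (X : ExteriorCalculus k A Ω)

theorem incl_mem (a : A) : X.incl a ∈ X.grade 0 := by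
  rw [← X.range_incl]; exact ⟨a, rfl⟩

/-- The `A`-bimodule `Ω^n` of forms of degree `n`. -/
def Form (n : ℕ) : Type w := X.grade n

instance (n : ℕ) : AddCommGroup (X.Form n) := inferInstanceAs (AddCommGroup (X.grade n))
instance (n : ℕ) : Module k (X.Form n) := inferInstanceAs (Module k (X.grade n))

instance (n : ℕ) : SMul A (X.Form n) where
  smul a α := ⟨X.incl a * α.1, by simpa using X.mul_mem (X.incl_mem a) α.2⟩

theorem Form.ext {n : ℕ} {α β : X.Form n} (h : α.1 = β.1) : α = β := Subtype.ext h

theorem smul_val {n : ℕ} (a : A) (α : X.Form n) : (a • α).1 = X.incl a * α.1 := rfl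
theorem add_val {n : ℕ} (α β : X.Form n) : (α + β).1 = α.1 + β.1 := rfl
theorem zero_val {n : ℕ} : (0 : X.Form n).1 = 0 := rfl
theorem ksmul_val {n : ℕ} (c : k) (α : X.Form n) : (c • α).1 = c • α.1 := rfl

instance (n : ℕ) : Module A (X.Form n) where
  one_smul α := Form.ext X (by simp [smul_val])
  mul_smul a b α := Form.ext X (by simp [smul_val, mul_assoc])
  smul_zero a := Form.ext X (by simp [smul_val, zero_val])
  smul_add a α β := Form.ext X (by simp [smul_val, add_val, mul_add])
  add_smul a b α := Form.ext X (by simp [smul_val, add_val, add_mul])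
  zero_smul α := Form.ext X (by simp [smul_val, zero_val])

instance (n : ℕ) : IsScalarTower k A (X.Form n) where
  smul_assoc c a α := Form.ext X (by simp [smul_val, ksmul_val])

/-- The right `A`-module structure of `Ω^n`. -/
def rmul {n : ℕ} (α : X.Form n) (a : A) : X.Form n :=
  ⟨α.1 * X.incl a, by simpa using X.mul_mem α.2 (X.incl_mem a)⟩

/-- The wedge product `da ∧ α` with the differential of `a`, for a `1`-form `α`. -/
def dWedge (a : A) (α : X.Form 1) : X.Form 2 :=
  ⟨X.d (X.incl a) * α.1, X.mul_mem (X.d_mem (X.incl_mem a)) α.2⟩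

/-- The differential `d : A → Ω^1`. -/
def dA : A →ₗ[k] X.Form 1 where
  toFun a := ⟨X.d (X.incl a), X.d_mem (X.incl_mem a)⟩
  map_add' a b := Form.ext X
    (show X.d (X.incl (a + b)) = X.d (X.incl a) + X.d (X.incl b) by simp)
  map_smul' c a := Form.ext X
    (show X.d (X.incl (c • a)) = c • X.d (X.incl a) by simp)

theorem dA_val (a : A) : (X.dA a).1 = X.d (X.incl a) := rfl

theorem d_incl_mul (a b : A) : X.d (X.incl (a * b)) =
    X.d (X.incl a) * X.incl b + X.incl a * X.d (X.incl b) := by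
  rw [map_mul, X.leibniz (X.incl_mem a)]; simp

/-- The kernel `N_d ⊆ A ⊗ A` of the projection onto the `1`-jets of `A`: the elements
`∑ aᵢ ⊗ bᵢ` with `∑ aᵢ bᵢ = 0` and `∑ aᵢ dbᵢ = 0`. -/
def relN : Submodule A (A ⊗[k] A) :=
  LinearMap.ker (extend (LinearMap.id : A →ₗ[k] A)) ⊓ LinearMap.ker (extend X.dA)

/-! ### The functor of 1-jets -/

section J1

variable (E : Type*) [AddCommGroup E] [Module k E] [Module A E] [IsScalarTower k A E]

/-- The image of `N_d ⊗ E` in `A ⊗ E` under `(a ⊗ b) ⊗ x ↦ a ⊗ b x`. -/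
def jetRel : Submodule A (A ⊗[k] E) := ⨆ x : E, X.relN.map (rightAct x)

/-- The module of `1`-jets `J^1 E = J^1 A ⊗_A E` with `J^1 A = (A ⊗ A) / N_d`, presented as
`(A ⊗ E) / N_d E`; the class of `a ⊗ (b x)` is `[a ⊗ b] ⊗_A x`. -/
def J1 : Type _ := (A ⊗[k] E) ⧸ X.jetRel E

instance : AddCommGroup (X.J1 E) := inferInstanceAs (AddCommGroup ((A ⊗[k] E) ⧸ X.jetRel E))
instance : Module A (X.J1 E) := inferInstanceAs (Module A ((A ⊗[k] E) ⧸ X.jetRel E))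
instance : Module k (X.J1 E) := inferInstanceAs (Module k ((A ⊗[k] E) ⧸ X.jetRel E))
instance : IsScalarTower k A (X.J1 E) :=
  inferInstanceAs (IsScalarTower k A ((A ⊗[k] E) ⧸ X.jetRel E))

variable {E}

/-- The projection `A ⊗ E → J^1 E`. -/
def J1.mk : A ⊗[k] E →ₗ[A] X.J1 E := (X.jetRel E).mkQ

theorem J1.hom_ext {P : Type*} [AddCommGroup P] [Module A P] {f g : X.J1 E →ₗ[A] P}
    (h : ∀ x : E, f (J1.mk X (1 ⊗ₜ x)) = g (J1.mk X (1 ⊗ₜ x))) : f = g := by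
  refine LinearMap.ext fun ξ => ?_
  obtain ⟨t, rfl⟩ := Submodule.mkQ_surjective _ ξ
  change f (J1.mk X t) = g (J1.mk X t)
  induction t with
  | zero => simp
  | add s t hs ht => simp only [map_add, hs, ht]
  | tmul a x =>
    have : (a ⊗ₜ[k] x : A ⊗[k] E) = a • ((1 : A) ⊗ₜ[k] x) := by
      rw [TensorProduct.smul_tmul', smul_eq_mul, mul_one]
    rw [this, map_smul, map_smul, map_smul, h]

/-- A `k`-linear map `g` whose extension to `A ⊗ E` kills the relations induces an `A`-linear
map on `1`-jets, `[a ⊗ x] ↦ a • g x`. -/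
def J1.lift {P : Type*} [AddCommGroup P] [Module k P] [Module A P] [IsScalarTower k A P]
    (g : E →ₗ[k] P)
    (hg : ∀ n ∈ X.relN, ∀ x : E, extend g (rightAct x n) = 0) : X.J1 E →ₗ[A] P :=
  (X.jetRel E).liftQ (extend g) (by
    refine iSup_le fun x => ?_
    rintro _ ⟨n, hn, rfl⟩
    exact hg n hn x)

@[simp] theorem J1.lift_mk {P : Type*} [AddCommGroup P] [Module k P] [Module A P]
    [IsScalarTower k A P] (g : E →ₗ[k] P)
    (hg : ∀ n ∈ X.relN, ∀ x : E, extend g (rightAct x n) = 0) (t : A ⊗[k] E) :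
    J1.lift X g hg (J1.mk X t) = extend g t := rfl

/-- The prolongation `j^1 : E → J^1 E`, `x ↦ [1 ⊗ x]`. -/
def j1 : E →ₗ[k] X.J1 E where
  toFun x := J1.mk X (1 ⊗ₜ x)
  map_add' x y := by rw [TensorProduct.tmul_add, map_add]
  map_smul' c x := by
    rw [TensorProduct.tmul_smul, RingHom.id_apply, ← algebraMap_smul A c, map_smul, algebraMap_smul]

theorem J1.mk_one_tmul (x : E) : J1.mk X (1 ⊗ₜ x) = X.j1 x := rfl

/-- The projection `π^{1,0} : J^1 E → E`, `[a ⊗ x] ↦ a x`. -/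
def pi10 : X.J1 E →ₗ[A] E :=
  J1.lift X LinearMap.id (by
    intro n hn x
    have h : (extend (LinearMap.id : E →ₗ[k] E)) ∘ₗ rightAct x =
        (LinearMap.toSpanSingleton A E x) ∘ₗ extend (LinearMap.id : A →ₗ[k] A) := by
      ext a; simp
    have := LinearMap.congr_fun h n
    simp only [LinearMap.comp_apply] at this
    rw [this, LinearMap.mem_ker.1 hn.1, map_zero])

theorem pi10_j1 (x : E) : X.pi10 (X.j1 x) = x := by
  change extend LinearMap.id ((1 : A) ⊗ₜ[k] x) = x
  simp

variable {F : Type*} [AddCommGroup F] [Module k F] [Module A F] [IsScalarTower k A F]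
  {G : Type*} [AddCommGroup G] [Module k G] [Module A G] [IsScalarTower k A G]

/-- The action of the functor `J^1` on an `A`-linear map: `[a ⊗ x] ↦ [a ⊗ f x]`. -/
def J1map (f : E →ₗ[A] F) : X.J1 E →ₗ[A] X.J1 F :=
  J1.lift X (X.j1 ∘ₗ f.restrictScalars k) (by
    intro n hn x
    have h : (extend (X.j1 ∘ₗ f.restrictScalars k)) ∘ₗ rightAct x =
        J1.mk X ∘ₗ rightAct (f x) := by
      ext a; simp [J1.mk_one_tmul]
    have := LinearMap.congr_fun h n
    simp only [LinearMap.comp_apply] at this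
    rw [this]
    exact (Submodule.Quotient.mk_eq_zero _).2
      (Submodule.mem_iSup_of_mem (f x) ⟨n, hn, rfl⟩))

@[simp] theorem J1map_j1 (f : E →ₗ[A] F) (x : E) : X.J1map f (X.j1 x) = X.j1 (f x) := by
  change extend (X.j1 ∘ₗ f.restrictScalars k) ((1 : A) ⊗ₜ[k] x) = _
  simp

theorem J1map_comp (g : F →ₗ[A] G) (f : E →ₗ[A] F) :
    X.J1map (g ∘ₗ f) = X.J1map g ∘ₗ X.J1map f :=
  J1.hom_ext X fun x => by simp [J1.mk_one_tmul]

end J1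

/-! ### The functor `Ω^1 ⋉ Ω^2` and the map cutting out holonomic jets -/

/-- The bimodule `Ω^1 ⋉ Ω^2`, with left action `a (α + β) = a α + da ∧ α + a β` and
componentwise right action. -/
def SemiForm : Type w := X.Form 1 × X.Form 2

instance : AddCommGroup X.SemiForm := inferInstanceAs (AddCommGroup (X.Form 1 × X.Form 2))
instance : Module k X.SemiForm := inferInstanceAs (Module k (X.Form 1 × X.Form 2))

instance : SMul A X.SemiForm where
  smul a s := (a • s.1, X.dWedge a s.1 + a • s.2)

theorem SemiForm.ext {s t : X.SemiForm} (h₁ : s.1.1 = t.1.1) (h₂ : s.2.1 = t.2.1) : s = t :=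
  Prod.ext (Subtype.ext h₁) (Subtype.ext h₂)

theorem SemiForm.smul_fst (a : A) (s : X.SemiForm) : (a • s).1.1 = X.incl a * s.1.1 := rfl
theorem SemiForm.smul_snd (a : A) (s : X.SemiForm) :
    (a • s).2.1 = X.d (X.incl a) * s.1.1 + X.incl a * s.2.1 := rfl
theorem SemiForm.add_fst (s t : X.SemiForm) : (s + t).1.1 = s.1.1 + t.1.1 := rfl
theorem SemiForm.add_snd (s t : X.SemiForm) : (s + t).2.1 = s.2.1 + t.2.1 := rfl
theorem SemiForm.zero_fst : (0 : X.SemiForm).1.1 = 0 := rfl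
theorem SemiForm.zero_snd : (0 : X.SemiForm).2.1 = 0 := rfl
theorem SemiForm.ksmul_fst (c : k) (s : X.SemiForm) : (c • s).1.1 = c • s.1.1 := rfl
theorem SemiForm.ksmul_snd (c : k) (s : X.SemiForm) : (c • s).2.1 = c • s.2.1 := rfl

theorem d_one : X.d 1 = 0 := by
  have := X.d_incl_mul 1 1
  simpa using this

instance : Module A X.SemiForm where
  one_smul s := SemiForm.ext X (by simp [SemiForm.smul_fst])
    (by simp [SemiForm.smul_snd, d_one])
  mul_smul a b s := SemiForm.ext X (by simp [SemiForm.smul_fst, mul_assoc])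
    (by
      simp only [SemiForm.smul_snd, SemiForm.smul_fst, d_incl_mul]
      rw [map_mul]; noncomm_ring)
  smul_zero a := SemiForm.ext X (by simp [SemiForm.smul_fst, SemiForm.zero_fst])
    (by simp [SemiForm.smul_snd, SemiForm.zero_fst, SemiForm.zero_snd])
  smul_add a s t := SemiForm.ext X
    (by simp [SemiForm.smul_fst, SemiForm.add_fst, mul_add])
    (by simp only [SemiForm.smul_snd, SemiForm.add_fst, SemiForm.add_snd]; noncomm_ring)
  add_smul a b s := SemiForm.ext X
    (by simp [SemiForm.smul_fst, SemiForm.add_fst, add_mul])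
    (by simp only [SemiForm.smul_snd, SemiForm.add_snd, map_add]; noncomm_ring)
  zero_smul s := SemiForm.ext X (by simp [SemiForm.smul_fst, SemiForm.zero_fst])
    (by simp [SemiForm.smul_snd, SemiForm.zero_snd])

instance : IsScalarTower k A X.SemiForm where
  smul_assoc c a s := SemiForm.ext X (by simp [SemiForm.smul_fst, SemiForm.ksmul_fst])
    (by simp [SemiForm.smul_snd, SemiForm.ksmul_snd])

/-- The componentwise right action on `Ω^1 ⋉ Ω^2`. -/
def SemiForm.rmul (s : X.SemiForm) (a : A) : X.SemiForm := (X.rmul s.1 a, X.rmul s.2 a)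

section Semi


variable (E : Type*) [AddCommGroup E] [Module k E] [Module A E] [IsScalarTower k A E]

/-- The relations `s a ⊗ x = s ⊗ a x` of the tensor product over `A`. -/
def semiRel : Submodule A (X.SemiForm ⊗[k] E) :=
  Submodule.span A {t | ∃ (s : X.SemiForm) (a : A) (x : E),
    t = SemiForm.rmul X s a ⊗ₜ[k] x - s ⊗ₜ[k] (a • x)}

/-- The left `A`-module `(Ω^1 ⋉ Ω^2)(E) = (Ω^1 ⋉ Ω^2) ⊗_A E`. -/
def Semi : Type _ := (X.SemiForm ⊗[k] E) ⧸ X.semiRel E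

instance : AddCommGroup (X.Semi E) :=
  inferInstanceAs (AddCommGroup ((X.SemiForm ⊗[k] E) ⧸ X.semiRel E))
instance : Module A (X.Semi E) :=
  inferInstanceAs (Module A ((X.SemiForm ⊗[k] E) ⧸ X.semiRel E))
instance : Module k (X.Semi E) :=
  inferInstanceAs (Module k ((X.SemiForm ⊗[k] E) ⧸ X.semiRel E))
instance : IsScalarTower k A (X.Semi E) :=
  inferInstanceAs (IsScalarTower k A ((X.SemiForm ⊗[k] E) ⧸ X.semiRel E))

variable {E}

/-- The class `s ⊗_A x` in `(Ω^1 ⋉ Ω^2)(E)`. -/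
def Semi.tmul (s : X.SemiForm) (x : E) : X.Semi E := (X.semiRel E).mkQ (s ⊗ₜ[k] x)

theorem Semi.rmul_tmul (s : X.SemiForm) (a : A) (x : E) :
    Semi.tmul X (SemiForm.rmul X s a) x = Semi.tmul X s (a • x) := by
  rw [← sub_eq_zero]
  exact (Submodule.Quotient.mk_eq_zero _).2 (Submodule.subset_span ⟨s, a, x, rfl⟩)

theorem Semi.smul_tmul (a : A) (s : X.SemiForm) (x : E) :
    a • Semi.tmul X s x = Semi.tmul X (a • s) x := rfl

/-- `s ⊗_A x` as an `A`-linear map in `s`. -/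
def Semi.tmulₗ (x : E) : X.SemiForm →ₗ[A] X.Semi E where
  toFun s := Semi.tmul X s x
  map_add' s t := by
    simp only [Semi.tmul]; rw [TensorProduct.add_tmul, map_add]; rfl
  map_smul' a s := rfl

variable {F : Type*} [AddCommGroup F] [Module k F] [Module A F] [IsScalarTower k A F]

/-- The action of the functor `Ω^1 ⋉ Ω^2` on an `A`-linear map. -/
def semiMap (f : E →ₗ[A] F) : X.Semi E →ₗ[A] X.Semi F :=
  (X.semiRel E).mapQ (X.semiRel F)
    (TensorProduct.AlgebraTensorModule.lTensor A X.SemiForm (f.restrictScalars k)) (by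
      refine Submodule.span_le.2 ?_
      rintro _ ⟨s, a, x, rfl⟩
      refine Submodule.subset_span ⟨s, a, f x, ?_⟩
      simp)

theorem semiMap_tmul (f : E →ₗ[A] F) (s : X.SemiForm) (x : E) :
    X.semiMap f (Semi.tmul X s x) = Semi.tmul X s (f x) := rfl

/-- The inclusion of `1`-forms in `Ω^1 ⋉ Ω^2`. -/
def embOne : X.Form 1 →ₗ[k] X.SemiForm := LinearMap.inl k (X.Form 1) (X.Form 2)

/-- The `1`-form `da`, seen in `Ω^1 ⋉ Ω^2`. -/
def dSemi : A →ₗ[k] X.SemiForm := embOne X ∘ₗ X.dA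

theorem dSemi_fst (a : A) : (X.dSemi a).1.1 = X.d (X.incl a) := rfl
theorem dSemi_snd (a : A) : (X.dSemi a).2.1 = 0 := rfl

/-- The `k`-linear map `A ⊗ E → (Ω^1 ⋉ Ω^2)(E)`, `c ⊗ x ↦ dc ⊗ x`. -/
def spencerAux : A ⊗[k] E →ₗ[k] X.Semi E :=
  ((X.semiRel E).mkQ.restrictScalars k) ∘ₗ TensorProduct.map X.dSemi LinearMap.id

theorem spencerAux_tmul (c : A) (x : E) :
    spencerAux X (c ⊗ₜ[k] x) = Semi.tmul X (X.dSemi c) x := rfl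

theorem extend_dSemi_fst (n : A ⊗[k] A) (c : A) :
    (extend (X.dSemi ∘ₗ (LinearMap.mulRight k c)) n).1.1 =
      (extend X.dA n).1 * X.incl c + X.incl (extend (LinearMap.id : A →ₗ[k] A) n) *
          X.d (X.incl c) := by
  induction n with
  | zero =>
    rw [map_zero, map_zero, map_zero, SemiForm.zero_fst, zero_val]; simp
  | add s t hs ht =>
    rw [map_add, map_add, map_add, SemiForm.add_fst, add_val, hs, ht, map_add]
    noncomm_ring
  | tmul a b =>
    rw [extend_tmul, SemiForm.smul_fst, extend_tmul, smul_val, extend_tmul, dA_val,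
      LinearMap.comp_apply, dSemi_fst, LinearMap.mulRight_apply, d_incl_mul, LinearMap.id_apply,
      smul_eq_mul, map_mul]
    noncomm_ring

theorem extend_dSemi_snd (n : A ⊗[k] A) (c : A) :
    (extend (X.dSemi ∘ₗ (LinearMap.mulRight k c)) n).2.1 =
      X.d (extend X.dA n).1 * X.incl c +
          (X.d (X.incl (extend (LinearMap.id : A →ₗ[k] A) n)) - (extend X.dA n).1) *
          X.d (X.incl c) := by
  induction n with
  | zero =>
    rw [map_zero, map_zero, map_zero, SemiForm.zero_snd, zero_val]; simp
  | add s t hs ht =>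
    rw [map_add, map_add, map_add, SemiForm.add_snd, add_val, hs, ht, map_add, map_add, map_add]
    noncomm_ring
  | tmul a b =>
    rw [extend_tmul, SemiForm.smul_snd, extend_tmul, smul_val, extend_tmul, dA_val,
      LinearMap.comp_apply, dSemi_fst, dSemi_snd, LinearMap.mulRight_apply, LinearMap.id_apply,
      smul_eq_mul, X.leibniz (X.incl_mem a), d_incl_mul, d_incl_mul, X.d_d]
    noncomm_ring

theorem extend_dSemi_eq_zero (n : A ⊗[k] A) (hn : n ∈ X.relN) (c : A) :
    extend (X.dSemi ∘ₗ (LinearMap.mulRight k c)) n = 0 := by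
  have h1 := LinearMap.mem_ker.1 hn.1
  have h2 := LinearMap.mem_ker.1 hn.2
  refine SemiForm.ext X ?_ ?_
  · rw [extend_dSemi_fst, h1, h2, zero_val, SemiForm.zero_fst]; simp
  · rw [extend_dSemi_snd, h1, h2, zero_val, SemiForm.zero_snd]; simp

theorem spencerAux_rightAct (x : E) (n : A ⊗[k] A) :
    spencerAux X (rightAct x n) = Semi.tmulₗ X x
      (X.dSemi (extend (LinearMap.id : A →ₗ[k] A) n) - embOne X (extend X.dA n)) := by
  induction n with
  | zero => simp
  | add s t hs ht =>
    rw [map_add, map_add, hs, ht, ← map_add]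
    congr 1
    simp only [map_add]
    abel
  | tmul a b =>
    rw [rightAct_tmul, spencerAux_tmul, ← Semi.rmul_tmul]
    refine congrArg (Semi.tmulₗ X x) (SemiForm.ext X ?_ ?_)
    · change X.d (X.incl a) * X.incl b = X.d (X.incl (a * b)) - X.incl a * X.d (X.incl b)
      rw [d_incl_mul]; simp
    · change 0 * X.incl b = 0 - 0
      simp

/-- The `k`-linear map `J^1 E → (Ω^1 ⋉ Ω^2)(E)`, `[a ⊗ b] ⊗ x ↦ (da) b ⊗ x`. -/
def spencer : X.J1 E →ₗ[k] X.Semi E :=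
  ((X.jetRel E).restrictScalars k).liftQ (spencerAux X) (by
    intro t ht
    rw [Submodule.restrictScalars_mem, jetRel] at ht
    rw [LinearMap.mem_ker]
    induction ht using Submodule.iSup_induction' with
    | mem x t ht =>
      obtain ⟨n, hn, rfl⟩ := ht
      have h1 := LinearMap.mem_ker.1 hn.1
      have h2 := LinearMap.mem_ker.1 hn.2
      rw [spencerAux_rightAct, h1, h2]
      simp
    | zero => simp
    | add s t _ _ hs ht => rw [map_add, hs, ht, add_zero])

theorem spencer_mk_tmul (c : A) (x : E) :
    X.spencer (J1.mk X (c ⊗ₜ x)) = Semi.tmul X (X.dSemi c) x := rfl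

theorem spencer_j1 (x : E) : X.spencer (X.j1 x) = 0 := by
  rw [← J1.mk_one_tmul, spencer_mk_tmul]
  refine Eq.trans ?_ (map_zero (Semi.tmulₗ X x))
  refine congrArg (Semi.tmulₗ X x) (SemiForm.ext X ?_ rfl)
  change X.d (X.incl 1) = 0
  rw [map_one, d_one]

/-- The `A`-linear map `D : J^1 J^1 E → (Ω^1 ⋉ Ω^2)(E)`,
`[a ⊗ b] ⊗ [c ⊗ x] ↦ (a d(bc) + da ∧ d(bc)) ⊗ x`. -/
def holD : X.J1 (X.J1 E) →ₗ[A] X.Semi E :=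
  J1.lift X X.spencer (by
    intro n hn ξ
    obtain ⟨t, rfl⟩ := Submodule.mkQ_surjective _ ξ
    change extend X.spencer (rightAct (J1.mk X t) n) = 0
    induction t with
    | zero =>
      have : (rightAct (J1.mk X (0 : A ⊗[k] E)) : A ⊗[k] A →ₗ[A] _) = 0 := by
        ext a; simp
      rw [this]; simp
    | add s t hs ht =>
      have : (rightAct (J1.mk X (s + t)) : A ⊗[k] A →ₗ[A] _) =
          rightAct (J1.mk X s) + rightAct (J1.mk X t) := by
        ext a; simp [TensorProduct.tmul_add]
      rw [this, LinearMap.add_apply, map_add, hs, ht, add_zero]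
    | tmul c x =>
      have h : (extend X.spencer) ∘ₗ rightAct (J1.mk X (c ⊗ₜ[k] x)) =
          Semi.tmulₗ X x ∘ₗ extend (X.dSemi ∘ₗ (LinearMap.mulRight k c)) := by
        ext b
        simp only [TensorProduct.AlgebraTensorModule.curry_apply, TensorProduct.curry_apply,
          LinearMap.coe_restrictScalars, LinearMap.comp_apply,
          rightAct_tmul, extend_tmul, one_smul]
        rw [← map_smul, TensorProduct.smul_tmul', smul_eq_mul, spencer_mk_tmul]
        rfl
      have := LinearMap.congr_fun h n
      simp only [LinearMap.comp_apply] at this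
      rw [this, extend_dSemi_eq_zero X n hn, map_zero])

theorem holD_j1 (ξ : X.J1 E) : X.holD (X.j1 ξ) = X.spencer ξ := by
  change extend X.spencer ((1 : A) ⊗ₜ[k] ξ) = _
  simp

theorem spencer_natural (f : E →ₗ[A] F) (ξ : X.J1 E) :
    X.spencer (X.J1map f ξ) = X.semiMap f (X.spencer ξ) := by
  obtain ⟨t, rfl⟩ := Submodule.mkQ_surjective _ ξ
  change X.spencer (X.J1map f (J1.mk X t)) = X.semiMap f (X.spencer (J1.mk X t))
  induction t with
  | zero => simp
  | add s t hs ht => simp only [map_add, hs, ht]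
  | tmul c x =>
    have : X.J1map f (J1.mk X (c ⊗ₜ x)) = J1.mk X (c ⊗ₜ f x) := by
      change extend (X.j1 ∘ₗ f.restrictScalars k) (c ⊗ₜ[k] x) = _
      rw [extend_tmul, LinearMap.comp_apply, ← J1.mk_one_tmul, ← map_smul,
        TensorProduct.smul_tmul', smul_eq_mul, mul_one]
      rfl
    rw [this]
    rfl

theorem holD_natural (f : E →ₗ[A] F) :
    X.holD ∘ₗ X.J1map (X.J1map f) = X.semiMap f ∘ₗ X.holD :=
  J1.hom_ext X fun ξ => by
    simp only [LinearMap.comp_apply, J1.mk_one_tmul, J1map_j1, holD_j1, spencer_natural]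

end Semi

/-! ### Holonomic jets and differential operators -/

section Jets

variable (E : Type u) [AddCommGroup E] [Module k E] [Module A E] [IsScalarTower k A E]
  (F : Type u) [AddCommGroup F] [Module k F] [Module A F] [IsScalarTower k A F]
  (G : Type u) [AddCommGroup G] [Module k G] [Module A G] [IsScalarTower k A G]

/-- Two consecutive jet modules `P = J^n E` and `Q = J^(n+1) E`, with the map `l : Q → J^1 P`
and the prolongations from `E`. -/
structure JetStage where
  P : LMod.{u} k A
  Q : LMod.{u} k A
  l : Q.carrier →ₗ[A] X.J1 P.carrier
  jP : E →ₗ[k] P.carrier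
  jQ : E →ₗ[k] Q.carrier
  comm : ∀ e, l (jQ e) = X.j1 (jP e)

/-- The first stage: `J^0 E = E` and `J^1 E`. -/
def jetStageZero : JetStage X E where
  P := ⟨E⟩
  Q := ⟨X.J1 E⟩
  l := LinearMap.id
  jP := LinearMap.id
  jQ := X.j1
  comm _ := rfl

variable {E} in
/-- The kernel of `J^1 J^(n+1) E → J^1 J^1 J^n E → (Ω^1 ⋉ Ω^2)(J^n E)`. -/
def JetStage.hol (S : JetStage X E) : Submodule A (X.J1 S.Q.carrier) :=
  LinearMap.ker (X.holD ∘ₗ X.J1map S.l)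

variable {E} in
/-- From `J^n E`, `J^(n+1) E` to `J^(n+1) E`, `J^(n+2) E`. -/
def JetStage.next (S : JetStage X E) : JetStage X E where
  P := S.Q
  Q := ⟨JetStage.hol X S⟩
  l := (JetStage.hol X S).subtype
  jP := S.jQ
  jQ := LinearMap.codRestrict ((JetStage.hol X S).restrictScalars k) (X.j1 ∘ₗ S.jQ) (fun e => by
    rw [Submodule.restrictScalars_mem, JetStage.hol, LinearMap.mem_ker]
    simp only [LinearMap.comp_apply, J1map_j1, S.comm, holD_j1, spencer_j1])
  comm _ := rfl

/-- The tower of holonomic jet modules of `E`. -/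
def jetStage : ℕ → JetStage X E
  | 0 => jetStageZero X E
  | n + 1 => JetStage.next X (jetStage n)

/-- The holonomic `n`-jets `J^n E`: `J^0 E = E`, `J^1 E` the `1`-jets, and `J^(n+2) E` the kernel
of `J^1 J^(n+1) E → J^1 J^1 J^n E → (Ω^1 ⋉ Ω^2)(J^n E)`. -/
abbrev Jet (n : ℕ) : Type u := (jetStage X E n).P.carrier

/-- The map `l^(n+1) : J^(n+1) E → J^1 J^n E`. -/
def jetL (n : ℕ) : X.Jet E (n + 1) →ₗ[A] X.J1 (X.Jet E n) := (jetStage X E n).l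

/-- The `n`-jet prolongation `j^n : E → J^n E`. -/
def jetJ (n : ℕ) : E →ₗ[k] X.Jet E n := (jetStage X E n).jP

/-- The jet projection `π^(n+1,n) : J^(n+1) E → J^n E`. -/
def jetPi (n : ℕ) : X.Jet E (n + 1) →ₗ[A] X.Jet E n := X.pi10 ∘ₗ X.jetL E n

variable {E} in
theorem jetL_jetJ (n : ℕ) (e : E) : X.jetL E n (X.jetJ E (n + 1) e) = X.j1 (X.jetJ E n e) :=
  (jetStage X E n).comm e

variable {E} in
theorem jetPi_jetJ (n : ℕ) (e : E) : X.jetPi E n (X.jetJ E (n + 1) e) = X.jetJ E n e := by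
  rw [jetPi, LinearMap.comp_apply, jetL_jetJ, pi10_j1]

/-- The linear differential operators `E → F` of order at most `n`: the `k`-linear maps that
factor as an `A`-linear map after the prolongation `j^n`. They form a left module over
`Hom_A(F, F)` under composition, `φ • Δ = φ ∘ Δ`. -/
def diffOp (n : ℕ) : Submodule (Module.End A F) (E →ₗ[k] F) where
  carrier := {Δ | ∃ L : X.Jet E n →ₗ[A] F, ∀ e, Δ e = L (X.jetJ E n e)}
  zero_mem' := ⟨0, fun e => rfl⟩
  add_mem' := by
    rintro Δ Δ' ⟨L, hL⟩ ⟨L', hL'⟩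
    exact ⟨L + L', fun e => by simp [hL, hL']⟩
  smul_mem' := by
    rintro φ Δ ⟨L, hL⟩
    exact ⟨φ ∘ₗ L, fun e => congrArg φ (hL e)⟩

/-- The differential operators of order strictly less than `n`. -/
def diffOpLT : ℕ → Submodule (Module.End A F) (E →ₗ[k] F)
  | 0 => ⊥
  | n + 1 => X.diffOp E F n

theorem diffOp_succ (n : ℕ) : X.diffOp E F n ≤ X.diffOp E F (n + 1) := by
  rintro Δ ⟨L, hL⟩
  exact ⟨L ∘ₗ X.jetPi E n, fun e => by rw [LinearMap.comp_apply, jetPi_jetJ, hL]⟩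

theorem diffOp_mono : Monotone (X.diffOp E F) := monotone_nat_of_le_succ (X.diffOp_succ E F)

variable {E F G}

/-- An `A`-linear map `J^m E → F` prolongs to compatible maps `J^(m+n) E → J^n F`. -/
theorem exists_prolong (m : ℕ) (L : X.Jet E m →ₗ[A] F) (n : ℕ) :
    ∃ (p : X.Jet E (m + n) →ₗ[A] X.Jet F n) (p' : X.Jet E (m + n + 1) →ₗ[A] X.Jet F (n + 1)),
      X.jetL F n ∘ₗ p' = X.J1map p ∘ₗ X.jetL E (m + n) ∧
      (∀ e, p (X.jetJ E (m + n) e) = X.jetJ F n (L (X.jetJ E m e))) ∧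
      ∀ e, p' (X.jetJ E (m + n + 1) e) = X.jetJ F (n + 1) (L (X.jetJ E m e)) := by
  induction n with
  | zero =>
    refine ⟨L, X.J1map L ∘ₗ X.jetL E m, rfl, fun e => rfl, fun e => ?_⟩
    change X.J1map L (X.jetL E m (X.jetJ E (m + 1) e)) = _
    rw [jetL_jetJ, J1map_j1]
    rfl
  | succ n ih =>
    obtain ⟨p, p', h, hp, hp'⟩ := ih
    have key : ∀ ξ : X.Jet E (m + n + 2),
        X.J1map p' (X.jetL E (m + n + 1) ξ) ∈ JetStage.hol X (jetStage X F n) := by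
      intro ξ
      have hξ : X.holD (X.J1map (X.jetL E (m + n)) (X.jetL E (m + n + 1) ξ)) = 0 :=
        LinearMap.mem_ker.1 ξ.2
      change X.holD (X.J1map (X.jetL F n) (X.J1map p' (X.jetL E (m + n + 1) ξ))) = 0
      rw [← LinearMap.comp_apply (X.J1map (X.jetL F n)), ← J1map_comp, h, J1map_comp,
        LinearMap.comp_apply, ← LinearMap.comp_apply X.holD, holD_natural, LinearMap.comp_apply,
        hξ, map_zero]
    let p'' : X.Jet E (m + n + 2) →ₗ[A] X.Jet F (n + 2) :=
      LinearMap.codRestrict (JetStage.hol X (jetStage X F n))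
        (X.J1map p' ∘ₗ X.jetL E (m + n + 1)) key
    refine ⟨p', p'', rfl, hp', fun e => Subtype.ext ?_⟩
    change X.J1map p' (X.jetL E (m + n + 1) (X.jetJ E (m + n + 2) e)) =
      X.jetL F (n + 1) (X.jetJ F (n + 2) (L (X.jetJ E m e)))
    rw [jetL_jetJ, jetL_jetJ, J1map_j1, hp']

/-- The composition of differential operators of orders at most `n` and `m` is one of order at
most `n + m`. -/
theorem comp_mem_diffOp {n m : ℕ} {Δ : F →ₗ[k] G} {Δ' : E →ₗ[k] F} (h : Δ ∈ X.diffOp F G n)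
    (h' : Δ' ∈ X.diffOp E F m) : Δ ∘ₗ Δ' ∈ X.diffOp E G (n + m) := by
  obtain ⟨L, hL⟩ := h
  obtain ⟨L', hL'⟩ := h'
  obtain ⟨p, -, -, hp, -⟩ := X.exists_prolong m L' n
  rw [add_comm]
  exact ⟨L ∘ₗ p, fun e => by
    rw [LinearMap.comp_apply, LinearMap.comp_apply, hp, hL, hL']⟩

theorem comp_mem_diffOpLT_left {n m : ℕ} {Δ : F →ₗ[k] G} {Δ' : E →ₗ[k] F}
    (h : Δ ∈ X.diffOpLT F G n) (h' : Δ' ∈ X.diffOp E F m) :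
    Δ ∘ₗ Δ' ∈ X.diffOpLT E G (n + m) := by
  cases n with
  | zero =>
    have : Δ = 0 := h
    rw [this, LinearMap.zero_comp]
    exact zero_mem _
  | succ n =>
    rw [Nat.succ_add]
    exact X.comp_mem_diffOp h h'

theorem comp_mem_diffOpLT_right {n m : ℕ} {Δ : F →ₗ[k] G} {Δ' : E →ₗ[k] F}
    (h : Δ ∈ X.diffOp F G n) (h' : Δ' ∈ X.diffOpLT E F m) :
    Δ ∘ₗ Δ' ∈ X.diffOpLT E G (n + m) := by
  cases m with
  | zero =>
    have : Δ' = 0 := h'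
    rw [this, LinearMap.comp_zero]
    exact zero_mem _
  | succ m => exact X.comp_mem_diffOp h h'

theorem id_mem_diffOp : (LinearMap.id : E →ₗ[k] E) ∈ X.diffOp E E 0 :=
  ⟨LinearMap.id, fun _ => rfl⟩

variable (E F)

/-- The symbols of order `n`: `Symb^n(E, F) = Diff^n(E, F) / Diff^(n-1)(E, F)`. -/
def Symb (n : ℕ) : Type _ :=
  X.diffOp E F n ⧸ (X.diffOpLT E F n).submoduleOf (X.diffOp E F n)

instance (n : ℕ) : AddCommGroup (X.Symb E F n) := inferInstanceAs (AddCommGroup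
  (X.diffOp E F n ⧸ (X.diffOpLT E F n).submoduleOf (X.diffOp E F n)))
instance (n : ℕ) : Module (Module.End A F) (X.Symb E F n) :=
  inferInstanceAs (Module (Module.End A F)
    (X.diffOp E F n ⧸ (X.diffOpLT E F n).submoduleOf (X.diffOp E F n)))
instance (n : ℕ) : Module k (X.Symb E F n) := inferInstanceAs (Module k
  (X.diffOp E F n ⧸ (X.diffOpLT E F n).submoduleOf (X.diffOp E F n)))
instance (n : ℕ) : IsScalarTower k (Module.End A F) (X.Symb E F n) :=
  inferInstanceAs (IsScalarTower k (Module.End A F)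
    (X.diffOp E F n ⧸ (X.diffOpLT E F n).submoduleOf (X.diffOp E F n)))

variable {E F}

/-- The symbol map `Diff^n(E, F) → Symb^n(E, F)`. -/
def symbol (n : ℕ) : X.diffOp E F n →ₗ[Module.End A F] X.Symb E F n :=
  ((X.diffOpLT E F n).submoduleOf (X.diffOp E F n)).mkQ

theorem symbol_eq_zero {n : ℕ} (Δ : X.diffOp E F n) :
    X.symbol n Δ = 0 ↔ Δ.1 ∈ X.diffOpLT E F n :=
  Submodule.Quotient.mk_eq_zero _

variable (E F) in
/-- A full quantization for `(E, F)`: a family of `Hom_A(F, F)`-linear right splittings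
`q^n : Symb^n(E, F) → Diff^n(E, F)` of the symbol maps. -/
structure FullQuantization where
  q : ∀ n : ℕ, X.Symb E F n →ₗ[Module.End A F] X.diffOp E F n
  symbol_q : ∀ (n : ℕ) (σ : X.Symb E F n), X.symbol n (q n σ) = σ

/-- The composition `Diff^n(F, G) × Diff^m(E, F) → Diff^(n+m)(E, G)`. -/
def diffComp (n m : ℕ) : X.diffOp F G n →ₗ[k] X.diffOp E F m →ₗ[k] X.diffOp E G (n + m) :=
  LinearMap.mk₂ k (fun Δ Δ' => ⟨Δ.1 ∘ₗ Δ'.1, X.comp_mem_diffOp Δ.2 Δ'.2⟩)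
    (fun _ _ _ => Subtype.ext (LinearMap.add_comp _ _ _))
    (fun _ _ _ => Subtype.ext (LinearMap.smul_comp _ _ _))
    (fun _ _ _ => Subtype.ext (LinearMap.comp_add _ _ _))
    (fun _ _ _ => Subtype.ext (LinearMap.comp_smul _ _ _))

theorem diffComp_val {n m : ℕ} (Δ : X.diffOp F G n) (Δ' : X.diffOp E F m) :
    (X.diffComp n m Δ Δ').1 = Δ.1 ∘ₗ Δ'.1 := rfl

/-- The product of symbols, `Symb^n(F, G) × Symb^m(E, F) → Symb^(n+m)(E, G)`: the product of the
symbols of two operators is the symbol of their composition. -/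
def symbMul {n m : ℕ} (a : X.Symb F G n) (b : X.Symb E F m) : X.Symb E G (n + m) :=
  Quotient.liftOn₂' a b (fun Δ Δ' => X.symbol (n + m) (X.diffComp n m Δ Δ')) (by
    intro Δ₁ Δ₁' Δ₂ Δ₂' h h'
    have h := (Submodule.quotientRel_def _).1 h
    have h' := (Submodule.quotientRel_def _).1 h'
    rw [← sub_eq_zero, ← map_sub, symbol_eq_zero]
    have : X.diffComp n m Δ₁ Δ₁' - X.diffComp n m Δ₂ Δ₂' =
        X.diffComp n m (Δ₁ - Δ₂) Δ₁' + X.diffComp n m Δ₂ (Δ₁' - Δ₂') := by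
      rw [map_sub, LinearMap.sub_apply, map_sub]; abel
    rw [this]
    exact add_mem (X.comp_mem_diffOpLT_left h Δ₁'.2) (X.comp_mem_diffOpLT_right Δ₂.2 h'))

theorem symbMul_symbol {n m : ℕ} (Δ : X.diffOp F G n) (Δ' : X.diffOp E F m) :
    X.symbMul (X.symbol n Δ) (X.symbol m Δ') = X.symbol (n + m) (X.diffComp n m Δ Δ') := rfl

namespace FullQuantization

variable {X} (Q : X.FullQuantization E F)

/-- One step of truncation: `Δ ↦ Δ - q^(n+1)(symbol of Δ)`, from order at most `n + 1` to order
at most `n`. -/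
def truncStep (n : ℕ) : X.diffOp E F (n + 1) →ₗ[Module.End A F] X.diffOp E F n :=
  LinearMap.codRestrict (X.diffOp E F n)
    ((X.diffOp E F (n + 1)).subtype ∘ₗ (LinearMap.id - Q.q (n + 1) ∘ₗ X.symbol (n + 1)))
    (fun Δ => by
      have h : X.symbol (n + 1) (Δ - Q.q (n + 1) (X.symbol (n + 1) Δ)) = 0 := by
        rw [map_sub, Q.symbol_q, sub_self]
      exact (X.symbol_eq_zero _).1 h)

/-- The `j`-truncation of an operator of order at most `n`: the operator itself if `n ≤ j`, and
otherwise obtained by successive truncation steps from order `n` down to order `j`. -/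
def trunc : ∀ n j : ℕ, X.diffOp E F n →ₗ[Module.End A F] X.diffOp E F j
  | 0, j => Submodule.inclusion (X.diffOp_mono E F (Nat.zero_le j))
  | n + 1, j =>
    if h : n + 1 ≤ j then Submodule.inclusion (X.diffOp_mono E F h)
    else trunc n j ∘ₗ Q.truncStep n

/-- The `j`-component of the total symbol: the `j`-symbol of the `j`-truncation of an operator of
order at most `n`. -/
def component (n j : ℕ) : X.diffOp E F n →ₗ[Module.End A F] X.Symb E F j :=
  X.symbol j ∘ₗ Q.trunc n j

end FullQuantization

variable (E) in
/-- The symbol module `Symb(E, E) = ⨁ Symb^n(E, E)`. -/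
abbrev SymbAlg : Type _ := ⨁ n : ℕ, X.Symb E E n

/-- The inclusion of the homogeneous symbols of degree `n`. -/
def symbOf (n : ℕ) : X.Symb E E n →ₗ[k] X.SymbAlg E :=
  DirectSum.lof k ℕ (fun n => X.Symb E E n) n

variable (E) in
/-- The identity of `E`, as a symbol of degree zero. -/
def symbOne : X.SymbAlg E := X.symbOf 0 (X.symbol 0 ⟨LinearMap.id, X.id_mem_diffOp⟩)

variable (E) in
/-- The submodule `⨁_{i < N} Symb^i(E, E)`. -/
def symbLT (N : ℕ) : Submodule k (X.SymbAlg E) :=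
  ⨆ i : Fin N, LinearMap.range (X.symbOf (E := E) i)

variable (E) in
/-- The module of polynomials `Symb(E, E)[h]`, where `h` is the variable of `k[X]`. -/
abbrev SymbPoly : Type _ := k[X] ⊗[k] X.SymbAlg E

namespace FullQuantization

variable {X} (Q : X.FullQuantization E E)

/-- The product `Symb^n × Symb^m → Symb[h]`,
`a ⋆ b = ∑_{i=0}^{n+m} h^i [q^n(a) ∘ q^m(b)]^(n+m-i)`. -/
def starHom (n m : ℕ) : X.Symb E E n →ₗ[k] X.Symb E E m →ₗ[k] X.SymbPoly E :=
  ∑ i ∈ Finset.range (n + m + 1),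
    ((X.diffComp n m).compl₁₂ ((Q.q n).restrictScalars k) ((Q.q m).restrictScalars k)).compr₂
      ((TensorProduct.mk k k[X] (X.SymbAlg E) (Polynomial.X ^ i)) ∘ₗ X.symbOf (n + m - i) ∘ₗ
        (Q.component (n + m) (n + m - i)).restrictScalars k)

theorem starHom_apply (n m : ℕ) (a : X.Symb E E n) (b : X.Symb E E m) :
    Q.starHom n m a b = ∑ i ∈ Finset.range (n + m + 1), (Polynomial.X ^ i : k[X]) ⊗ₜ[k]
      X.symbOf (n + m - i) (Q.component (n + m) (n + m - i)
        (X.diffComp n m (Q.q n a) (Q.q m b))) := by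
  simp [starHom, LinearMap.sum_apply]

/-- The `k`-bilinear extension `Symb × Symb → Symb[h]`. -/
def star : X.SymbAlg E →ₗ[k] X.SymbAlg E →ₗ[k] X.SymbPoly E :=
  DirectSum.toModule k ℕ _ fun n =>
    (DirectSum.toModule k ℕ (X.Symb E E n →ₗ[k] X.SymbPoly E) fun m =>
      (Q.starHom n m).flip).flip

theorem star_symbOf (n m : ℕ) (a : X.Symb E E n) (b : X.Symb E E m) :
    Q.star (X.symbOf n a) (X.symbOf m b) = Q.starHom n m a b := by
  simp [star, symbOf]

/-- The formal star product: the `k[h]`-bilinear extension to `Symb[h]`. -/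
def formalStar : X.SymbPoly E →ₗ[k[X]] X.SymbPoly E →ₗ[k[X]] X.SymbPoly E :=
  LinearMap.liftBaseChange k[X]
    (((LinearMap.liftBaseChangeEquiv k[X] (M := X.SymbAlg E) (N := X.SymbPoly E)).restrictScalars
      k).toLinearMap ∘ₗ Q.star)

theorem formalStar_tmul (p r : k[X]) (s t : X.SymbAlg E) :
    Q.formalStar (p ⊗ₜ s) (r ⊗ₜ t) = (p * r) • Q.star s t := by
  simp [formalStar, mul_smul]

end FullQuantization

variable (E) in
/-- The evaluation `Symb[h] → Symb` at `h = ħ`. -/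
def evalAt (ħ : k) : X.SymbPoly E →ₗ[k] X.SymbAlg E :=
  TensorProduct.lift ((LinearMap.lsmul k (X.SymbAlg E)) ∘ₗ Polynomial.leval ħ)

theorem evalAt_tmul (ħ : k) (p : k[X]) (s : X.SymbAlg E) :
    X.evalAt E ħ (p ⊗ₜ s) = p.eval ħ • s := rfl

/-- The star product with parameter `ħ`: `a ⋆ b` evaluated at `h = ħ`. -/
def FullQuantization.starAt {X : ExteriorCalculus k A Ω} (Q : X.FullQuantization E E) (ħ : k) :
    X.SymbAlg E →ₗ[k] X.SymbAlg E →ₗ[k] X.SymbAlg E :=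
  Q.star.compr₂ (X.evalAt E ħ)

end Jets

end ExteriorCalculus

end Calculus

/-- `mul`, `one` make the `R`-module `M` into a unital associative algebra, filtered by the
increasing exhaustive family of submodules `F`. -/
structure IsFilteredAlgebra {R M : Type*} [CommRing R] [AddCommGroup M] [Module R M]
    (mul : M →ₗ[R] M →ₗ[R] M) (one : M) (F : ℕ → Submodule R M) : Prop where
  mul_assoc : ∀ a b c, mul (mul a b) c = mul a (mul b c)
  one_mul : ∀ a, mul one a = a
  mul_one : ∀ a, mul a one = a
  mono : Monotone F
  exhaustive : ∀ a, ∃ n, a ∈ F n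
  one_mem : one ∈ F 0
  mul_mem : ∀ {m n a b}, a ∈ F m → b ∈ F n → mul a b ∈ F (m + n)

/-- The two-sided ideal generated by an element, for a bilinear product on a module. -/
def twoSidedIdeal {R M : Type*} [CommRing R] [AddCommGroup M] [Module R M]
    (mul : M →ₗ[R] M →ₗ[R] M) (x : M) : Submodule R M :=
  sInf {I | x ∈ I ∧ ∀ a ∈ I, ∀ b, mul a b ∈ I ∧ mul b a ∈ I}

end NCJet

end

/-!
Sending `a ∈ Symbⁿ` to `hⁿ qⁿ(a)` defines a `k[h]`-linear map `Symb[h] → End(E)[h]`. It is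
injective, because the terms of a sum `∑ qⁿ(aₙ)` are recovered from the top order downwards by
taking symbols, and because `h` is not a zero divisor on `Symb[h]`. Every operator `Δ` of order
`N` is the sum of the `qʲ([Δ]ʲ)`, and in the formal star product of `a ∈ Symbⁿ` and `b ∈ Symbᵐ`
the weight `hⁱ` of the component of degree `n + m - i` makes up the missing powers of `h`; so the
map takes the formal star product to composition, and associativity and the unit laws are inherited
from `End(E)[h]`. Finally `ev_ħ` is a surjective homomorphism with kernel `(h - ħ) Symb[h]`, which
transfers everything to the star product with parameter `ħ`.
-/

noncomputable section

namespace NCJet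

section FilteredAlgebra

variable {R S M N : Type*} [CommRing R] [CommRing S] [AddCommGroup M] [Module R M]
  [AddCommGroup N] [Module S N]

theorem IsFilteredAlgebra.map {σ : R →+* S} [RingHomSurjective σ] {mul : M →ₗ[R] M →ₗ[R] M}
    {one : M} {F : ℕ → Submodule R M} (h : IsFilteredAlgebra mul one F) (φ : M →ₛₗ[σ] N)
    (hφ : Function.Surjective φ) {mul' : N →ₗ[S] N →ₗ[S] N}
    (map_mul : ∀ x y, φ (mul x y) = mul' (φ x) (φ y)) :
    IsFilteredAlgebra mul' (φ one) fun n => (F n).map φ where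
  mul_assoc := hφ.forall₃.2 fun x y z => by simp only [← map_mul, h.mul_assoc]
  one_mul := hφ.forall.2 fun x => by rw [← map_mul, h.one_mul]
  mul_one := hφ.forall.2 fun x => by rw [← map_mul, h.mul_one]
  mono _ _ hmn := Submodule.map_mono (h.mono hmn)
  exhaustive := hφ.forall.2 fun x => (h.exhaustive x).imp fun _ => Submodule.mem_map_of_mem
  one_mem := Submodule.mem_map_of_mem h.one_mem
  mul_mem := by
    rintro m n _ _ ⟨x, hx, rfl⟩ ⟨y, hy, rfl⟩
    exact ⟨mul x y, h.mul_mem hx hy, map_mul x y⟩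

theorem twoSidedIdeal_smul_one {mul : M →ₗ[R] M →ₗ[R] M} {one : M} (one_mul : ∀ a, mul one a = a)
    (c : R) : twoSidedIdeal mul (c • one) = LinearMap.range (LinearMap.lsmul R M c) := by
  refine le_antisymm (sInf_le ⟨⟨one, rfl⟩, ?_⟩) (le_sInf fun I hI => ?_)
  · rintro _ ⟨a, rfl⟩ b
    exact ⟨⟨mul a b, by simp⟩, ⟨mul b a, by simp⟩⟩
  · rintro _ ⟨a, rfl⟩
    simpa [one_mul] using (hI.2 _ hI.1 a).1

end FilteredAlgebra

section BaseChange

variable {R S M N P : Type*} [CommSemiring R] [CommSemiring S] [Algebra R S] [AddCommMonoid M]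
  [Module R M] [AddCommMonoid N] [Module R N] [AddCommMonoid P] [Module S P]

theorem exists_mem_baseChange {ι : Type*} [Nonempty ι] [Preorder ι] [IsDirectedOrder ι]
    {F : ι → Submodule R M} (hF : Monotone F) (exhaustive : ∀ s, ∃ i, s ∈ F i) (x : S ⊗[R] M) :
    ∃ i, x ∈ (F i).baseChange S := by
  induction x using TensorProduct.induction_on with
  | zero => exact ⟨Classical.arbitrary ι, zero_mem _⟩
  | tmul p s =>
    obtain ⟨i, hi⟩ := exhaustive s
    exact ⟨i, Submodule.tmul_mem_baseChange_of_mem p hi⟩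
  | add x y hx hy =>
    obtain ⟨i, hi⟩ := hx
    obtain ⟨j, hj⟩ := hy
    obtain ⟨l, hil, hjl⟩ := exists_ge_ge i j
    exact ⟨l, add_mem (Submodule.baseChange_mono _ (hF hil) hi)
      (Submodule.baseChange_mono _ (hF hjl) hj)⟩

theorem map₂_baseChange_le {f : S ⊗[R] M →ₗ[S] S ⊗[R] N →ₗ[S] P} {U : Submodule R M}
    {V : Submodule R N} {W : Submodule S P}
    (h : ∀ s ∈ U, ∀ t ∈ V, f (1 ⊗ₜ s) (1 ⊗ₜ t) ∈ W) :
    Submodule.map₂ f (U.baseChange S) (V.baseChange S) ≤ W := by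
  rw [Submodule.baseChange_eq_span, Submodule.baseChange_eq_span, Submodule.map₂_span_span,
    Submodule.span_le]
  rintro _ ⟨_, ⟨s, hs, rfl⟩, _, ⟨t, ht, rfl⟩, rfl⟩
  exact h s hs t ht

end BaseChange

section Evaluation

variable {k M : Type*} [CommRing k] [AddCommGroup M] [Module k M] (ħ : k)

instance : RingHomSurjective (Polynomial.evalRingHom ħ) :=
  ⟨fun c => ⟨Polynomial.C c, Polynomial.eval_C⟩⟩

/-- The evaluation `M[h] → M` at `h = ħ`, as a map semilinear over the evaluation `k[h] → k`. -/
def evalTensor : k[X] ⊗[k] M →ₛₗ[Polynomial.evalRingHom ħ] M where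
  __ := TensorProduct.lift (LinearMap.lsmul k M ∘ₗ Polynomial.leval ħ)
  map_smul' p x := by
    induction x using TensorProduct.induction_on with
    | zero => simp
    | tmul r s => simp [TensorProduct.smul_tmul', mul_smul]
    | add x y hx hy => simp_all

@[simp]
theorem evalTensor_tmul (p : k[X]) (s : M) : evalTensor ħ (p ⊗ₜ[k] s) = p.eval ħ • s := rfl

theorem evalTensor_one_tmul (s : M) : evalTensor ħ (1 ⊗ₜ[k] s) = s := by simp

theorem evalTensor_surjective : Function.Surjective (evalTensor (M := M) ħ) := fun s =>
  ⟨1 ⊗ₜ s, evalTensor_one_tmul ħ s⟩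

theorem sub_one_tmul_evalTensor_mem_range (x : k[X] ⊗[k] M) :
    x - 1 ⊗ₜ evalTensor ħ x ∈
      LinearMap.range (LinearMap.lsmul k[X] (k[X] ⊗[k] M) (Polynomial.X - Polynomial.C ħ)) := by
  induction x using TensorProduct.induction_on with
  | zero => simp
  | tmul p s =>
    obtain ⟨g, hg⟩ := Polynomial.X_sub_C_dvd_sub_C_eval (a := ħ) (p := p)
    refine ⟨g ⊗ₜ s, ?_⟩
    rw [evalTensor_tmul, LinearMap.lsmul_apply, TensorProduct.smul_tmul', smul_eq_mul, ← hg,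
      TensorProduct.sub_tmul, ← TensorProduct.smul_tmul, ← Polynomial.C_mul', mul_one]
  | add x y hx hy =>
    rw [map_add, TensorProduct.tmul_add, add_sub_add_comm]
    exact add_mem hx hy

theorem ker_evalTensor :
    LinearMap.ker (evalTensor (M := M) ħ) =
      LinearMap.range (LinearMap.lsmul k[X] (k[X] ⊗[k] M) (Polynomial.X - Polynomial.C ħ)) := by
  refine le_antisymm (fun x hx => ?_) ?_
  · have h := sub_one_tmul_evalTensor_mem_range ħ x
    rwa [LinearMap.mem_ker.1 hx, TensorProduct.tmul_zero, sub_zero] at h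
  · rintro _ ⟨y, rfl⟩
    simp

theorem map_evalTensor_baseChange (N : Submodule k M) :
    (N.baseChange k[X]).map (evalTensor ħ) = N := by
  rw [Submodule.baseChange_eq_span, Submodule.map_span, Submodule.map_coe, ← Set.image_comp]
  convert N.span_eq
  exact (Set.image_congr fun s _ => evalTensor_one_tmul ħ s).trans (Set.image_id _)

end Evaluation

section Rescale

variable {k : Type*} [CommRing k] {M : ℕ → Type*} [∀ n, AddCommGroup (M n)]
  [∀ n, Module k (M n)] {N : Type*} [AddCommGroup N] [Module k N]

theorem isSMulRegular_X : IsSMulRegular (k[X] ⊗[k] N) (Polynomial.X : k[X]) := by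
  rw [(PolynomialModule.polynomialTensorProductLEquivPolynomialModule
    (R := k) (M := N)).isSMulRegular_congr]
  intro x y h
  refine PolynomialModule.ext (Finsupp.ext fun n => ?_)
  simpa [← Polynomial.monomial_one_one_eq_X, PolynomialModule.monomial_smul_apply] using
    congrArg (fun z => z.coeff (1 + n)) h

variable (M) in
/-- The `k[h]`-linear endomorphism of `(⨁ n, M n)[h]` multiplying `M n` by `h ^ n`. -/
def rescale : k[X] ⊗[k] (⨁ n, M n) →ₗ[k[X]] k[X] ⊗[k] (⨁ n, M n) :=
  (TensorProduct.directSumRight k k[X] k[X] M).symm ∘ₗ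
    DirectSum.lmap (fun n => LinearMap.lsmul k[X] (k[X] ⊗[k] M n) (Polynomial.X ^ n)) ∘ₗ
    (TensorProduct.directSumRight k k[X] k[X] M).toLinearMap

theorem rescale_tmul_lof (p : k[X]) (n : ℕ) (a : M n) :
    rescale M (p ⊗ₜ[k] DirectSum.lof k ℕ M n a) =
      (p * Polynomial.X ^ n) ⊗ₜ[k] DirectSum.lof k ℕ M n a := by
  simp [rescale, TensorProduct.smul_tmul', mul_comm]

theorem rescale_injective : Function.Injective (rescale (k := k) M) := by
  have h : Function.Injective (DirectSum.lmap (R := k[X]) fun n =>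
      LinearMap.lsmul k[X] (k[X] ⊗[k] M n) (Polynomial.X ^ n)) :=
    (DirectSum.lmap_injective _).2 fun n => isSMulRegular_X.pow n
  simpa [rescale] using h

end Rescale

section Graded

variable {k : Type*} [CommSemiring k] {M : ℕ → Type*} [∀ n, AddCommMonoid (M n)]
  [∀ n, Module k (M n)]

variable (k M) in
/-- The submodule `⨁_{i < N} M i` of a direct sum; `symbLT` is the case of symbols. -/
def degreeLT (N : ℕ) : Submodule k (⨁ n, M n) :=
  ⨆ i : Fin N, LinearMap.range (DirectSum.lof k ℕ M i)

theorem lof_mem_degreeLT {n N : ℕ} (h : n < N) (a : M n) :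
    DirectSum.lof k ℕ M n a ∈ degreeLT k M N :=
  Submodule.mem_iSup_of_mem (⟨n, h⟩ : Fin N) ⟨a, rfl⟩

theorem degreeLT_le {N : ℕ} {P : Submodule k (⨁ n, M n)}
    (h : ∀ n < N, ∀ a, DirectSum.lof k ℕ M n a ∈ P) : degreeLT k M N ≤ P :=
  iSup_le fun i => LinearMap.range_le_iff_comap.2 (eq_top_iff.2 fun a _ => h i i.2 a)

theorem degreeLT_mono : Monotone (degreeLT k M) := fun _ _ hN =>
  degreeLT_le fun _ hn => lof_mem_degreeLT (hn.trans_le hN)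

theorem degreeLT_zero : degreeLT k M 0 = ⊥ := iSup_of_empty _

theorem degreeLT_succ_le (N : ℕ) :
    degreeLT k M (N + 1) ≤ degreeLT k M N ⊔ LinearMap.range (DirectSum.lof k ℕ M N) :=
  degreeLT_le fun n hn a => by
    obtain hn | rfl := Nat.lt_succ_iff_lt_or_eq.1 hn
    · exact Submodule.mem_sup_left (lof_mem_degreeLT hn a)
    · exact Submodule.mem_sup_right ⟨a, rfl⟩

theorem exists_mem_degreeLT_succ (s : ⨁ n, M n) : ∃ N, s ∈ degreeLT k M (N + 1) := by
  induction s using DirectSum.induction_on with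
  | zero => exact ⟨0, zero_mem _⟩
  | of n a => exact ⟨n, lof_mem_degreeLT n.lt_succ_self a⟩
  | add s t hs ht =>
    obtain ⟨n, hn⟩ := hs
    obtain ⟨m, hm⟩ := ht
    exact ⟨max n m, add_mem (degreeLT_mono (by omega) hn) (degreeLT_mono (by omega) hm)⟩

theorem map₂_degreeLT_le {M' : ℕ → Type*} [∀ n, AddCommMonoid (M' n)] [∀ n, Module k (M' n)]
    {P : Type*} [AddCommMonoid P] [Module k P] {f : (⨁ n, M n) →ₗ[k] (⨁ n, M' n) →ₗ[k] P}
    {m n : ℕ} {W : Submodule k P}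
    (h : ∀ i < m, ∀ j < n, ∀ a b, f (DirectSum.lof k ℕ M i a) (DirectSum.lof k ℕ M' j b) ∈ W) :
    Submodule.map₂ f (degreeLT k M m) (degreeLT k M' n) ≤ W := by
  simp only [degreeLT, Submodule.map₂_iSup_left, Submodule.map₂_iSup_right, iSup_le_iff,
    Submodule.map₂_le]
  rintro j i _ ⟨a, rfl⟩ _ ⟨b, rfl⟩
  exact h i i.2 j j.2 a b

theorem toModule_mem_of_mem_degreeLT {N : Type*} [AddCommMonoid N] [Module k N]
    {f : ∀ n, M n →ₗ[k] N} {D : ℕ → Submodule k N} (hD : Monotone D)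
    (hf : ∀ n a, f n a ∈ D (n + 1)) {n : ℕ} {s : ⨁ n, M n} (hs : s ∈ degreeLT k M n) :
    DirectSum.toModule k ℕ N f s ∈ D n := by
  have h : degreeLT k M n ≤ (D n).comap (DirectSum.toModule k ℕ N f) :=
    degreeLT_le fun i hi a => by
      simpa only [Submodule.mem_comap, DirectSum.toModule_lof] using hD hi (hf i a)
  exact h hs

end Graded

section Triangular

variable {k : Type*} [CommRing k] {M : ℕ → Type*} [∀ n, AddCommGroup (M n)]
  [∀ n, Module k (M n)] {N : Type*} [AddCommGroup N] [Module k N] {f : ∀ n, M n →ₗ[k] N}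
  {D : ℕ → Submodule k N}

theorem toModule_injective_of_triangular (hD : Monotone D) (hf : ∀ n a, f n a ∈ D (n + 1))
    (eq_zero_of_mem : ∀ n a, f n a ∈ D n → a = 0) :
    Function.Injective (DirectSum.toModule k ℕ N f) := by
  suffices eq_zero : ∀ n, ∀ s ∈ degreeLT k M n, DirectSum.toModule k ℕ N f s = 0 → s = 0 by
    refine (injective_iff_map_eq_zero _).2 fun s hs => ?_
    obtain ⟨n, hn⟩ := exists_mem_degreeLT_succ (k := k) s
    exact eq_zero _ s hn hs
  intro n
  induction n with
  | zero => exact fun s hs _ => (Submodule.mem_bot k).1 (degreeLT_zero (k := k) (M := M) ▸ hs)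
  | succ n ih =>
    intro s hs hfs
    obtain ⟨s', hs', _, ⟨a, rfl⟩, rfl⟩ := Submodule.mem_sup.1 (degreeLT_succ_le n hs)
    rw [map_add, DirectSum.toModule_lof] at hfs
    have ha : a = 0 := eq_zero_of_mem n a <| by
      rw [eq_neg_of_add_eq_zero_right hfs]
      exact neg_mem (toModule_mem_of_mem_degreeLT hD hf hs')
    subst ha
    rw [map_zero, add_zero] at hfs ⊢
    exact ih s' hs' hfs

end Triangular

namespace ExteriorCalculus.FullQuantization

variable {k : Type v} {A : Type u} {Ω : Type w} [CommRing k] [Ring A] [Algebra k A]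
  [Ring Ω] [Algebra k Ω] {X : ExteriorCalculus k A Ω}
  {E : Type u} [AddCommGroup E] [Module k E] [Module A E] [IsScalarTower k A E]

section TotalQuantization

variable {F : Type u} [AddCommGroup F] [Module k F] [Module A F] [IsScalarTower k A F]
  (Q : X.FullQuantization E F)

theorem q_symbol_zero (Δ : X.diffOp E F 0) : Q.q 0 (X.symbol 0 Δ) = Δ := by
  have h : X.symbol 0 (Q.q 0 (X.symbol 0 Δ) - Δ) = 0 := by rw [map_sub, Q.symbol_q, sub_self]
  exact sub_eq_zero.1 (Subtype.ext ((X.symbol_eq_zero _).1 h))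

theorem trunc_self (n : ℕ) (Δ : X.diffOp E F n) : Q.trunc n n Δ = Δ := by
  cases n with
  | zero => rfl
  | succ n => rw [trunc, dif_pos le_rfl]; rfl

theorem component_self (n : ℕ) (Δ : X.diffOp E F n) : Q.component n n Δ = X.symbol n Δ := by
  rw [component, LinearMap.comp_apply, trunc_self]

theorem component_succ {n j : ℕ} (h : j ≤ n) (Δ : X.diffOp E F (n + 1)) :
    Q.component (n + 1) j Δ = Q.component n j (Q.truncStep n Δ) := by
  rw [component, LinearMap.comp_apply, trunc, dif_neg (by omega)]
  rfl

theorem coe_truncStep (n : ℕ) (Δ : X.diffOp E F (n + 1)) :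
    (Q.truncStep n Δ).1 = Δ.1 - (Q.q (n + 1) (X.symbol (n + 1) Δ)).1 := rfl

theorem sum_q_component (n : ℕ) (Δ : X.diffOp E F n) :
    ∑ j ∈ Finset.range (n + 1), (Q.q j (Q.component n j Δ)).1 = Δ.1 := by
  induction n with
  | zero => rw [Finset.sum_range_one, component_self, q_symbol_zero]
  | succ n ih =>
    have lower : ∑ j ∈ Finset.range (n + 1), (Q.q j (Q.component (n + 1) j Δ)).1 =
        (Q.truncStep n Δ).1 := by
      rw [← ih]
      exact Finset.sum_congr rfl fun j hj => by
        rw [Q.component_succ (Finset.mem_range_succ_iff.1 hj)]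
    rw [Finset.sum_range_succ, lower, component_self, coe_truncStep, sub_add_cancel]

/-- The total quantization `∑ aₙ ↦ ∑ qⁿ(aₙ)`, from symbols of all orders to operators. -/
def totalQuantization : (⨁ n, X.Symb E F n) →ₗ[k] E →ₗ[k] F :=
  DirectSum.toModule k ℕ _ fun n => ((X.diffOp E F n).subtype ∘ₗ Q.q n).restrictScalars k

theorem totalQuantization_lof (n : ℕ) (a : X.Symb E F n) :
    Q.totalQuantization (DirectSum.lof k ℕ _ n a) = (Q.q n a).1 := by
  simp [totalQuantization]

theorem totalQuantization_injective : Function.Injective Q.totalQuantization := by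
  refine toModule_injective_of_triangular (D := fun n => (X.diffOpLT E F n).restrictScalars k)
    (monotone_nat_of_le_succ fun n => ?_) (fun n a => (Q.q n a).2) fun n a ha => ?_
  · cases n with
    | zero => exact fun Δ hΔ => (Submodule.mem_bot _).1 hΔ ▸ zero_mem _
    | succ n => exact X.diffOp_succ E F n
  · rw [← Q.symbol_q n a]
    exact (X.symbol_eq_zero _).2 ha

/-- The formal quantization `∑ aₙ ↦ ∑ hⁿ qⁿ(aₙ)`, extended `k[h]`-linearly to polynomials. -/
def formalQuantization :
    k[X] ⊗[k] (⨁ n, X.Symb E F n) →ₗ[k[X]] k[X] ⊗[k] (E →ₗ[k] F) :=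
  Q.totalQuantization.baseChange k[X] ∘ₗ rescale _

theorem formalQuantization_tmul_lof (p : k[X]) (n : ℕ) (a : X.Symb E F n) :
    Q.formalQuantization (p ⊗ₜ[k] DirectSum.lof k ℕ _ n a) =
      (p * Polynomial.X ^ n) ⊗ₜ[k] (Q.q n a).1 := by
  rw [formalQuantization, LinearMap.comp_apply, rescale_tmul_lof, LinearMap.baseChange_tmul,
    totalQuantization_lof]

theorem formalQuantization_injective : Function.Injective Q.formalQuantization :=
  (Module.Flat.lTensor_preserves_injective_linearMap (M := k[X]) _
    Q.totalQuantization_injective).comp rescale_injective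

end TotalQuantization

section FormalStar

variable (Q : X.FullQuantization E E)

theorem formalQuantization_tmul_symbOf (p : k[X]) (n : ℕ) (a : X.Symb E E n) :
    Q.formalQuantization (p ⊗ₜ[k] X.symbOf n a) = (p * Polynomial.X ^ n) ⊗ₜ[k] (Q.q n a).1 :=
  Q.formalQuantization_tmul_lof p n a

theorem formalQuantization_starHom (n m : ℕ) (a : X.Symb E E n) (b : X.Symb E E m) :
    Q.formalQuantization (Q.starHom n m a b) =
      (Polynomial.X ^ (n + m)) ⊗ₜ[k] ((Q.q n a).1 ∘ₗ (Q.q m b).1) := by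
  rw [starHom_apply, map_sum, ← diffComp_val, ← Q.sum_q_component, TensorProduct.tmul_sum,
    ← Finset.sum_range_reflect]
  refine Finset.sum_congr rfl fun j hj => ?_
  have hj : j ≤ n + m := Finset.mem_range_succ_iff.1 hj
  have reflect : n + m + 1 - 1 - j = n + m - j := by omega
  rw [formalQuantization_tmul_symbOf, ← pow_add, reflect, Nat.sub_sub_self hj,
    Nat.sub_add_cancel hj]

theorem formalStar_tmul_symbOf (n m : ℕ) (a : X.Symb E E n) (b : X.Symb E E m) :
    Q.formalStar (1 ⊗ₜ[k] X.symbOf n a) (1 ⊗ₜ[k] X.symbOf m b) = Q.starHom n m a b := by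
  rw [formalStar_tmul, star_symbOf, one_mul, one_smul]

theorem formalQuantization_formalStar (x y : X.SymbPoly E) :
    (Q.formalQuantization (Q.formalStar x y) : k[X] ⊗[k] Module.End k E) =
      Q.formalQuantization x * Q.formalQuantization y := by
  let φ : X.SymbPoly E →ₗ[k[X]] k[X] ⊗[k] Module.End k E := Q.formalQuantization
  suffices H : Q.formalStar.compr₂ φ = (LinearMap.mul k[X] _).compl₁₂ φ φ from
    LinearMap.congr_fun₂ H x y
  ext n a m b : 8
  change φ (Q.formalStar (1 ⊗ₜ X.symbOf n a) (1 ⊗ₜ X.symbOf m b)) =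
    φ (1 ⊗ₜ X.symbOf n a) * φ (1 ⊗ₜ X.symbOf m b)
  rw [formalStar_tmul_symbOf]
  simp only [φ, formalQuantization_starHom, formalQuantization_tmul_symbOf,
    Algebra.TensorProduct.tmul_mul_tmul, one_mul, pow_add, Module.End.mul_eq_comp]

theorem formalQuantization_one :
    Q.formalQuantization (1 ⊗ₜ[k] X.symbOne E) = (1 : k[X] ⊗[k] Module.End k E) := by
  rw [symbOne, formalQuantization_tmul_symbOf, q_symbol_zero, pow_zero, one_mul]
  rfl

theorem starHom_mem (n m : ℕ) (a : X.Symb E E n) (b : X.Symb E E m) :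
    Q.starHom n m a b ∈ (X.symbLT E (n + m + 1)).baseChange k[X] := by
  rw [starHom_apply]
  exact sum_mem fun i _ =>
    Submodule.tmul_mem_baseChange_of_mem _ (lof_mem_degreeLT (by omega) _)

theorem star_mem {n m : ℕ} {s t : X.SymbAlg E} (hs : s ∈ X.symbLT E (n + 1))
    (ht : t ∈ X.symbLT E (m + 1)) :
    Q.star s t ∈ (X.symbLT E (n + m + 1)).baseChange k[X] := by
  refine map₂_degreeLT_le (W := ((X.symbLT E (n + m + 1)).baseChange k[X]).restrictScalars k)
    (fun i hi j hj a b => ?_) (Submodule.apply_mem_map₂ Q.star hs ht)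
  exact Submodule.baseChange_mono _ (degreeLT_mono (by omega : i + j + 1 ≤ n + m + 1))
    (Q.star_symbOf i j a b ▸ Q.starHom_mem i j a b)

theorem formalStar_mem {n m : ℕ} {x y : X.SymbPoly E}
    (hx : x ∈ (X.symbLT E (n + 1)).baseChange k[X])
    (hy : y ∈ (X.symbLT E (m + 1)).baseChange k[X]) :
    Q.formalStar x y ∈ (X.symbLT E (n + m + 1)).baseChange k[X] :=
  map₂_baseChange_le (fun s hs t ht => by
    rw [formalStar_tmul]
    exact Submodule.smul_mem _ _ (Q.star_mem hs ht)) (Submodule.apply_mem_map₂ Q.formalStar hx hy)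

theorem one_formalStar (x : X.SymbPoly E) : Q.formalStar (1 ⊗ₜ[k] X.symbOne E) x = x :=
  Q.formalQuantization_injective <| by
    rw [formalQuantization_formalStar, formalQuantization_one, one_mul]

theorem isFilteredAlgebra_formalStar :
    IsFilteredAlgebra Q.formalStar (1 ⊗ₜ[k] X.symbOne E)
      (fun n => (X.symbLT E (n + 1)).baseChange k[X]) where
  mul_assoc x y z := Q.formalQuantization_injective <| by
    simp only [formalQuantization_formalStar, mul_assoc]
  one_mul := Q.one_formalStar
  mul_one x := Q.formalQuantization_injective <| by
    rw [formalQuantization_formalStar, formalQuantization_one, mul_one]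
  mono _ _ h := Submodule.baseChange_mono _ (degreeLT_mono (Nat.succ_le_succ h))
  exhaustive := exists_mem_baseChange (fun _ _ h => degreeLT_mono (Nat.succ_le_succ h))
    exists_mem_degreeLT_succ
  one_mem := Submodule.tmul_mem_baseChange_of_mem 1 (lof_mem_degreeLT Nat.zero_lt_one _)
  mul_mem := Q.formalStar_mem

theorem component_diffComp_q (n m : ℕ) (a : X.Symb E E n) (b : X.Symb E E m) :
    Q.component (n + m) (n + m) (X.diffComp n m (Q.q n a) (Q.q m b)) = X.symbMul a b := by
  rw [component_self, ← symbMul_symbol, Q.symbol_q, Q.symbol_q]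

theorem exists_formalStar_sub_symbMul (n m : ℕ) (a : X.Symb E E n) (b : X.Symb E E m) :
    ∃ r ∈ (X.symbLT E (n + m)).baseChange k[X],
      Q.formalStar (1 ⊗ₜ[k] X.symbOf n a) (1 ⊗ₜ[k] X.symbOf m b) -
          1 ⊗ₜ[k] X.symbOf (n + m) (X.symbMul a b) = (Polynomial.X : k[X]) • r := by
  refine ⟨∑ i ∈ Finset.range (n + m), (Polynomial.X ^ i : k[X]) ⊗ₜ[k]
      X.symbOf (n + m - (i + 1)) (Q.component (n + m) (n + m - (i + 1))
        (X.diffComp n m (Q.q n a) (Q.q m b))), sum_mem fun i hi => ?_, ?_⟩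
  · have := Finset.mem_range.1 hi
    exact Submodule.tmul_mem_baseChange_of_mem _ (lof_mem_degreeLT (by omega) _)
  · rw [formalStar_tmul_symbOf, starHom_apply, Finset.sum_range_succ', pow_zero, Nat.sub_zero,
      component_diffComp_q, add_sub_cancel_right, Finset.smul_sum]
    simp only [TensorProduct.smul_tmul', smul_eq_mul, pow_succ']

end FormalStar

section StarAt

variable (Q : X.FullQuantization E E) (ħ : k)

theorem evalTensor_formalStar (x y : X.SymbPoly E) :
    evalTensor ħ (Q.formalStar x y) = Q.starAt ħ (evalTensor ħ x) (evalTensor ħ y) := by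
  induction x using TensorProduct.induction_on with
  | zero => simp
  | add x x' hx hx' => simp only [map_add, LinearMap.add_apply, hx, hx']
  | tmul p s =>
    induction y using TensorProduct.induction_on with
    | zero => simp
    | add y y' hy hy' => simp only [map_add, hy, hy']
    | tmul r t =>
      have star_eval : evalTensor ħ (Q.star s t) = Q.starAt ħ s t := rfl
      simp only [formalStar_tmul, map_smulₛₗ, evalTensor_tmul, star_eval, LinearMap.smul_apply,
        Polynomial.coe_evalRingHom, mul_smul, RingHom.id_apply]
      exact smul_comm _ _ _

theorem isFilteredAlgebra_starAt :
    IsFilteredAlgebra (Q.starAt ħ) (X.symbOne E) (fun n => X.symbLT E (n + 1)) := by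
  simpa only [evalTensor_one_tmul, map_evalTensor_baseChange] using
    Q.isFilteredAlgebra_formalStar.map (evalTensor ħ) (evalTensor_surjective ħ)
      (Q.evalTensor_formalStar ħ)

theorem exists_starAt_sub_symbMul (n m : ℕ) (a : X.Symb E E n) (b : X.Symb E E m) :
    ∃ r ∈ X.symbLT E (n + m),
      Q.starAt ħ (X.symbOf n a) (X.symbOf m b) - X.symbOf (n + m) (X.symbMul a b) = ħ • r := by
  obtain ⟨r, hr, h⟩ := Q.exists_formalStar_sub_symbMul n m a b
  refine ⟨evalTensor ħ r, ?_, ?_⟩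
  · rw [← map_evalTensor_baseChange ħ (X.symbLT E (n + m))]
    exact Submodule.mem_map_of_mem hr
  · simpa only [map_sub, map_smulₛₗ, evalTensor_formalStar, evalTensor_one_tmul,
      Polynomial.coe_evalRingHom, Polynomial.eval_X] using congrArg (evalTensor ħ) h

theorem twoSidedIdeal_X_sub_C :
    twoSidedIdeal Q.formalStar ((Polynomial.X - Polynomial.C ħ : k[X]) ⊗ₜ[k] X.symbOne E) =
      LinearMap.ker (evalTensor ħ) := by
  rw [ker_evalTensor, ← twoSidedIdeal_smul_one Q.one_formalStar, TensorProduct.smul_tmul',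
    smul_eq_mul, mul_one]

/-- The isomorphism induced by the evaluation at `h = ħ` from the quotient of `Symb[h]` by the
ideal generated by `h - ħ` onto `Symb`. -/
def quotientEquiv :
    (X.SymbPoly E ⧸ twoSidedIdeal Q.formalStar
      ((Polynomial.X - Polynomial.C ħ : k[X]) ⊗ₜ[k] X.symbOne E)) ≃ₗ[k] X.SymbAlg E :=
  (Submodule.quotEquivOfEq _ _ (Q.twoSidedIdeal_X_sub_C ħ)).restrictScalars k ≪≫ₗ
    (X.evalAt E ħ).quotKerEquivOfSurjective (evalTensor_surjective ħ)

theorem quotientEquiv_mk (x : X.SymbPoly E) :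
    Q.quotientEquiv ħ (Submodule.Quotient.mk x) = X.evalAt E ħ x := rfl

end StarAt

end ExteriorCalculus.FullQuantization

end NCJet

end

open NCJet ExteriorCalculus in
theorem proposition5p35 {k : Type v} {A : Type u} {Ω : Type w} [CommRing k] [Ring A]
    [Algebra k A] [Ring Ω] [Algebra k Ω] (X : ExteriorCalculus k A Ω)
    (E : Type u) [AddCommGroup E] [Module k E] [Module A E] [IsScalarTower k A E]
    (Q : X.FullQuantization E E) :
    -- the formal star product
    IsFilteredAlgebra Q.formalStar (1 ⊗ₜ[k] X.symbOne E)
        (fun n => (X.symbLT E (n + 1)).baseChange k[X]) ∧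
      (∀ (n m : ℕ) (a : X.Symb E E n) (b : X.Symb E E m),
        ∃ r ∈ (X.symbLT E (n + m)).baseChange k[X],
          Q.formalStar (1 ⊗ₜ[k] X.symbOf n a) (1 ⊗ₜ[k] X.symbOf m b) -
              1 ⊗ₜ[k] X.symbOf (n + m) (X.symbMul a b) = (Polynomial.X : k[X]) • r) ∧
      -- the star product with parameter
      ∀ ħ : k,
        IsFilteredAlgebra (Q.starAt ħ) (X.symbOne E) (fun n => X.symbLT E (n + 1)) ∧
        (∀ n : ℕ, X.symbLT E (n + 1) =
          (((X.symbLT E (n + 1)).baseChange k[X]).restrictScalars k).map (X.evalAt E ħ)) ∧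
        (∃ φ : (X.SymbPoly E ⧸ twoSidedIdeal Q.formalStar
              ((Polynomial.X - Polynomial.C ħ : k[X]) ⊗ₜ[k] X.symbOne E)) ≃ₗ[k] X.SymbAlg E,
          (∀ x : X.SymbPoly E, φ (Submodule.Quotient.mk x) = X.evalAt E ħ x) ∧
          φ (Submodule.Quotient.mk (1 ⊗ₜ[k] X.symbOne E)) = X.symbOne E ∧
          ∀ x y : X.SymbPoly E, φ (Submodule.Quotient.mk (Q.formalStar x y)) =
            Q.starAt ħ (φ (Submodule.Quotient.mk x)) (φ (Submodule.Quotient.mk y))) ∧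
        ∀ (n m : ℕ) (a : X.Symb E E n) (b : X.Symb E E m),
          ∃ r ∈ X.symbLT E (n + m),
            Q.starAt ħ (X.symbOf n a) (X.symbOf m b) - X.symbOf (n + m) (X.symbMul a b) =
              ħ • r :=
  ⟨Q.isFilteredAlgebra_formalStar, Q.exists_formalStar_sub_symbMul, fun ħ =>
    ⟨Q.isFilteredAlgebra_starAt ħ, fun _ => (map_evalTensor_baseChange ħ _).symm,
      ⟨Q.quotientEquiv ħ, Q.quotientEquiv_mk ħ, evalTensor_one_tmul ħ _,
        Q.evalTensor_formalStar ħ⟩,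
      Q.exists_starAt_sub_symbMul ħ⟩⟩
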